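/- Let $(M,g)$ be a real-analytic $2$-dimensional Riemannian manifold without boundary (with real-analytic metric $g$), and let $p\in M$. Then there are an open neighbourhood $U$ of $p$, an open interval $(a,b)\subset\mathbb R$ with its Euclidean metric, and a real-analytic Riemannian submersion $f$ of $U$ onto $(a,b)$; that is, $f:U\to(a,b)$ is real-analytic and surjective, and at every $x\in U$ the differential $df_x:T_xM\to\mathbb R$ is surjective and satisfies $df_x(v)\,df_x(w)=g_x(v,w)$ for all $v,w\in(\ker df_x)^{\perp}$. Moreover, $U$ and $f$ can be chosen so that the fibres of $f$ are the leaves of a codimension-$1$ (Riemannian) foliation of $U$ with a global foliated chart: there is a real-analytic chart $\varphi$ of $M$ with domain $U$ and image an open rectangle $(a,b)\times(c,d)$ whose first coordinate is $f$. -/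

import Mathlib

open Bundle
open scoped Manifold ContDiff

/-- `f` restricts to a `C^n` Riemannian submersion on the open set `U ⊆ M`: it is `C^n` on `U`, and
at each point of `U` its differential is onto and preserves inner products of horizontal vectors,
i.e. of vectors orthogonal to the vertical space `ker df`. -/
structure IsRiemannianSubmersionOn
    {E : Type*} [NormedAddCommGroup E] [NormedSpace ℝ E]
    {H : Type*} [TopologicalSpace H] (I : ModelWithCorners ℝ E H)
    {E' : Type*} [NormedAddCommGroup E'] [NormedSpace ℝ E']
    {H' : Type*} [TopologicalSpace H'] (J : ModelWithCorners ℝ E' H')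
    {M : Type*} [TopologicalSpace M] [ChartedSpace H M]
    [RiemannianBundle (fun x : M ↦ TangentSpace I x)]
    {N : Type*} [TopologicalSpace N] [ChartedSpace H' N]
    [RiemannianBundle (fun y : N ↦ TangentSpace J y)]
    (n : ℕ∞ω) (f : M → N) (U : Set M) : Prop where
  isOpen : IsOpen U
  contMDiffOn : ContMDiffOn I J n f U
  surjective : ∀ x ∈ U, Function.Surjective (mfderiv I J f x)
  inner_eq : ∀ x ∈ U, ∀ v w : TangentSpace I x,
    (∀ k : TangentSpace I x, mfderiv I J f x k = 0 → inner ℝ k v = 0) →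
    (∀ k : TangentSpace I x, mfderiv I J f x k = 0 → inner ℝ k w = 0) →
    inner ℝ (mfderiv I J f x v) (mfderiv I J f x w) = inner ℝ v w

/-- The map `f : M → ℝ` defines a codimension-one Riemannian foliation of class `C^n` of the open
set `U` of the surface `M`, with leaves the level sets of `f` in `U`, and with leaf space the open
interval `(a, b)` with its Euclidean metric: `f` is a Riemannian submersion of `U` onto `(a, b)`,
and `f` is the first coordinate of a chart (a foliated chart) which maps `U` onto an open rectangle
`(a, b) × (c, d)`; the leaves are the slices `{t} × (c, d)`. -/
structure IsRiemannianFoliationBy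
    {M : Type*} [TopologicalSpace M] [ChartedSpace (EuclideanSpace ℝ (Fin 2)) M]
    [RiemannianBundle (fun x : M ↦ TangentSpace (𝓡 2) x)]
    (n : ℕ∞ω) (f : M → ℝ) (U : Set M) (a b : ℝ) : Prop where
  submersion : IsRiemannianSubmersionOn (𝓡 2) 𝓘(ℝ, ℝ) n f U
  image_eq : f '' U = Set.Ioo a b
  foliatedChart : ∃ φ ∈ IsManifold.maximalAtlas (𝓡 2) n M, ∃ c d : ℝ,
    φ.source = U ∧ φ.target = {z | z 0 ∈ Set.Ioo a b ∧ z 1 ∈ Set.Ioo c d} ∧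
    ∀ x ∈ U, φ x 0 = f x

/-! A function is a Riemannian submersion to the line as soon as its gradient has length one, so the
core is to solve the eikonal equation `|df| = 1` near `p` by the method of characteristics.

Let `A` be the cometric, the inverse of the metric in a chart, and `H(x, ξ) = ξ(A ξ) / 2`. Start
from a coordinate line through `p` with its unit conormal covectors and follow the Hamiltonian flow
of `H`, that is, unit-speed geodesics leaving the line orthogonally. `H` is conserved, so `ξ` stays
of unit length; by the Gauss lemma `ξ` stays conormal to the time fronts
(`eventually_characteristics`). Hence `ξ = dt`, where `t` is time. By the inverse function theorem,
`t` and the position `y` on the line form a chart (`exists_eikonal_chart`), and `f = t`.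

Analyticity of `f` rests on analytic dependence of the flow on time and initial data
(`AnalyticAt.exists_flow`). It comes from the analytic implicit function theorem for the integral
equation in `C([0,1], E)`, whose nonlinearity is analytic by `AnalyticAt.exists_superposition`. -/

open Filter Topology Set

/-! ### Superposition operators on spaces of continuous functions -/

section Superposition

variable {𝕜 K E F : Type*} [NontriviallyNormedField 𝕜] [TopologicalSpace K] [CompactSpace K]
  [NormedAddCommGroup E] [NormedSpace 𝕜 E] [NormedAddCommGroup F] [NormedSpace 𝕜 F]

/-- A continuous multilinear map acts pointwise on continuous functions on a compact space. -/
noncomputable def ContinuousMultilinearMap.compContinuousMap {n : ℕ}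
    (f : ContinuousMultilinearMap 𝕜 (fun _ : Fin n ↦ E) F) :
    ContinuousMultilinearMap 𝕜 (fun _ : Fin n ↦ C(K, E)) C(K, F) :=
  MultilinearMap.mkContinuous
    { toFun := fun m ↦ ⟨fun t ↦ f fun i ↦ m i t, by fun_prop⟩
      map_update_add' := by
        intro _ m i x y
        ext t
        have h (u : C(K, E)) : (fun j ↦ Function.update m i u j t) =
            Function.update (fun j ↦ m j t) i (u t) := by
          ext j; by_cases hj : j = i
          · subst hj; simp
          · simp [hj]
        simp [h]
      map_update_smul' := by
        intro _ m i c x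
        ext t
        have h (u : C(K, E)) : (fun j ↦ Function.update m i u j t) =
            Function.update (fun j ↦ m j t) i (u t) := by
          ext j; by_cases hj : j = i
          · subst hj; simp
          · simp [hj]
        simp [h] } ‖f‖ <| by
    intro m
    refine (ContinuousMap.norm_le _ (by positivity)).2 fun t ↦ ?_
    refine (f.le_opNorm _).trans ?_
    gcongr with i
    exact (m i).norm_coe_le_norm t

@[simp]
theorem ContinuousMultilinearMap.compContinuousMap_apply {n : ℕ}
    (f : ContinuousMultilinearMap 𝕜 (fun _ : Fin n ↦ E) F) (m : Fin n → C(K, E)) (t : K) :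
    f.compContinuousMap m t = f fun i ↦ m i t := rfl

theorem ContinuousMultilinearMap.norm_compContinuousMap_le {n : ℕ}
    (f : ContinuousMultilinearMap 𝕜 (fun _ : Fin n ↦ E) F) :
    ‖(f.compContinuousMap : ContinuousMultilinearMap 𝕜 (fun _ : Fin n ↦ C(K, E)) C(K, F))‖ ≤ ‖f‖ :=
  MultilinearMap.mkContinuous_norm_le _ (norm_nonneg _) _

/-- Superposition with an analytic function is analytic near a constant function. -/
theorem AnalyticAt.exists_superposition [CompleteSpace F] {g : E → F} {z : E}
    (hg : AnalyticAt 𝕜 g z) :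
    ∃ N : C(K, E) → C(K, F), AnalyticAt 𝕜 N (ContinuousMap.const K z) ∧
      ∀ᶠ u in 𝓝 (ContinuousMap.const K z), ∀ t, N u t = g (u t) := by
  obtain ⟨p, r, hp⟩ := hg
  let q : FormalMultilinearSeries 𝕜 C(K, E) C(K, F) := fun n ↦ (p n).compContinuousMap
  -- Acting pointwise does not increase the norm of a coefficient, so no convergence is lost.
  have hq : p.radius ≤ q.radius := by
    refine ENNReal.le_of_forall_nnreal_lt fun ρ hρ ↦ ?_
    obtain ⟨C, -, hC⟩ := p.norm_mul_pow_le_of_lt_radius hρ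
    refine q.le_radius_of_bound C fun n ↦ le_trans ?_ (hC n)
    gcongr
    exact (p n).norm_compContinuousMap_le
  have hr : r ≤ q.radius := hp.r_le.trans hq
  have hq0 : 0 < q.radius := hp.r_pos.trans_le hr
  refine ⟨fun u ↦ q.sum (u - ContinuousMap.const K z), ?_, ?_⟩
  · have h := (q.hasFPowerSeriesOnBall hq0).analyticAt
    exact h.comp_of_eq (analyticAt_id.sub analyticAt_const) (sub_self _)
  · filter_upwards [Metric.eball_mem_nhds (ContinuousMap.const K z) hp.r_pos] with u hu t
    have hu' : u - ContinuousMap.const K z ∈ Metric.eball (0 : C(K, E)) r := by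
      simpa [Metric.mem_eball, edist_eq_enorm_sub] using hu
    have h1 := (q.hasFPowerSeriesOnBall hq0).hasSum (Metric.eball_subset_eball hr hu')
    -- Evaluation at `t` is continuous and linear, so it carries the series in `C(K, F)` to the
    -- series of `g` at `u t`.
    have h2 := (ContinuousMap.evalCLM 𝕜 t : C(K, F) →L[𝕜] F).hasSum h1
    have hut : u t - z ∈ Metric.eball (0 : E) r := by
      simp only [Metric.mem_eball, edist_zero_right] at hu' ⊢
      refine lt_of_le_of_lt ?_ hu'
      exact enorm_le_iff_norm_le.2 ((u - ContinuousMap.const K z).norm_coe_le_norm t)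
    have h3 := hp.hasSum hut
    rw [add_sub_cancel] at h3
    simp only [zero_add] at h2
    exact h2.unique (by simpa [Function.comp_def, q] using h3)

end Superposition

/-! ### Analytic flow of an analytic vector field -/

section Flow

variable {E : Type*} [NormedAddCommGroup E] [NormedSpace ℝ E]

open unitInterval

/-- The primitive vanishing at `0` of a continuous function on the unit interval. -/
noncomputable def ContinuousMap.primitive [CompleteSpace E] : C(I, E) →L[ℝ] C(I, E) :=
  LinearMap.mkContinuous
    { toFun := fun v ↦ ⟨fun t ↦ ∫ r in (0 : ℝ)..t, v (projIcc 0 1 zero_le_one r), by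
        have h : Continuous fun r : ℝ ↦ v (projIcc 0 1 zero_le_one r) := by fun_prop
        have h' := intervalIntegral.continuous_primitive
          (fun a b ↦ h.intervalIntegrable (μ := MeasureTheory.volume) a b) 0
        exact h'.comp continuous_subtype_val⟩
      map_add' := by
        intro v w
        ext t
        simp only [ContinuousMap.coe_mk, ContinuousMap.add_apply]
        exact intervalIntegral.integral_add (Continuous.intervalIntegrable (by fun_prop) _ _)
          (Continuous.intervalIntegrable (by fun_prop) _ _)
      map_smul' := by
        intro c v
        ext t
        simp [intervalIntegral.integral_smul] } 1 <| by
    intro v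
    refine (ContinuousMap.norm_le _ (by positivity)).2 fun t ↦ ?_
    refine (intervalIntegral.norm_integral_le_of_norm_le_const (C := ‖v‖)
      fun r _ ↦ v.norm_coe_le_norm _).trans ?_
    rw [sub_zero, abs_of_nonneg t.2.1, one_mul]
    exact mul_le_of_le_one_right (norm_nonneg _) t.2.2

theorem ContinuousMap.primitive_apply [CompleteSpace E] (v : C(I, E)) (t : I) :
    ContinuousMap.primitive v t = ∫ r in (0 : ℝ)..t, v (projIcc 0 1 zero_le_one r) := rfl

/-- Reparametrization of the unit interval by multiplication by an element of it. -/
def unitInterval.mulLeft (t : I) : C(I, I) := ⟨fun r ↦ t * r, by fun_prop⟩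

/-- The substitution `r ↦ t r` in the integral. It turns a solution of the integral equation for
time `s` into one for time `t s`. -/
theorem ContinuousMap.smul_primitive_comp_mulLeft [CompleteSpace E] (v : C(I, E)) (t : I) :
    (t : ℝ) • ContinuousMap.primitive (v.comp (unitInterval.mulLeft t)) =
      (ContinuousMap.primitive v).comp (unitInterval.mulLeft t) := by
  ext r
  have h := intervalIntegral.smul_integral_comp_mul_left (a := 0) (b := r)
    (fun x : ℝ ↦ v (projIcc 0 1 zero_le_one x)) (t : ℝ)
  rw [mul_zero] at h
  simp only [ContinuousMap.smul_apply, ContinuousMap.comp_apply, primitive_apply]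
  refine Eq.trans ?_ (h.trans rfl)
  congr 1
  refine intervalIntegral.integral_congr fun x hx ↦ ?_
  rw [uIcc_of_le r.2.1] at hx
  have hx1 : x ∈ I := ⟨hx.1, hx.2.trans r.2.2⟩
  have hx2 : (t : ℝ) * x ∈ I := unitInterval.mul_mem t.2 hx1
  rw [projIcc_of_mem _ hx1, projIcc_of_mem _ hx2]
  rfl

/-- An analytic vector field on a Banach space has an analytic local flow. -/
theorem AnalyticAt.exists_flow [CompleteSpace E] {X : E → E} {z₀ : E} (hX : AnalyticAt ℝ X z₀) :
    ∃ Φ : ℝ × E → E, AnalyticAt ℝ Φ (0, z₀) ∧ (∀ᶠ z in 𝓝 z₀, Φ (0, z) = z) ∧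
      ∀ᶠ p in 𝓝 ((0 : ℝ), z₀), fderiv ℝ Φ p (1, 0) = X (Φ p) := by
  obtain ⟨N, hN, hNX⟩ := hX.exists_superposition (K := I)
  set u₀ : C(I, E) := ContinuousMap.const I z₀
  let cst : E →L[ℝ] C(I, E) := ContinuousLinearMap.const ℝ I
  -- With time rescaled to `[0,1]`, the curve `u(t) = Φ(ts, z)` is characterised by `u = z + s ∫
  -- X(u)`; `G` is the defect of this equation.
  let G : (ℝ × E) × C(I, E) → C(I, E) := fun w ↦
    w.2 - cst w.1.2 - w.1.1 • ContinuousMap.primitive (N w.2)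
  let b : (ℝ × E) × C(I, E) := ((0, z₀), u₀)
  have hNc : ContDiffAt ℝ ω N u₀ := hN.contDiffAt
  have hG : ContDiffAt ℝ ω G b := by
    have : ContDiffAt ℝ ω (fun w : (ℝ × E) × C(I, E) ↦ N w.2) b := hNc.comp b contDiffAt_snd
    fun_prop
  have hGb : G b = 0 := by
    ext t
    simp [G, b, u₀, cst]
  -- At `s = 0` the integral term disappears and `G` is a translation in `u`.
  have hinv : fderiv ℝ G b ∘L .inr ℝ (ℝ × E) C(I, E) = ContinuousLinearMap.id ℝ _ := by
    have h1 : HasFDerivAt G (fderiv ℝ G b) b :=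
      (hG.differentiableAt (by simp)).hasFDerivAt
    have h2 : HasFDerivAt (fun v : C(I, E) ↦ (((0 : ℝ), z₀), v))
        (ContinuousLinearMap.inr ℝ (ℝ × E) C(I, E)) u₀ := hasFDerivAt_prodMk_right _ _
    have h3 := HasFDerivAt.comp u₀ (f := fun v : C(I, E) ↦ (((0 : ℝ), z₀), v)) h1 h2
    have h4 : HasFDerivAt (G ∘ fun v : C(I, E) ↦ (((0 : ℝ), z₀), v))
        (ContinuousLinearMap.id ℝ _) u₀ := by
      have : (G ∘ fun v : C(I, E) ↦ (((0 : ℝ), z₀), v)) = fun v ↦ id v - cst z₀ := by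
        ext v t; simp [G]
      rw [this]
      exact (hasFDerivAt_id _).sub_const _
    exact h3.unique h4
  have hinv' : (fderiv ℝ G b ∘L .inr ℝ (ℝ × E) C(I, E)).IsInvertible := by
    rw [hinv]; exact ⟨ContinuousLinearEquiv.refl ℝ _, rfl⟩
  let ψ := hG.implicitFunction (by simp) hinv'
  have hψ : ContDiffAt ℝ ω ψ (0, z₀) := hG.contDiffAt_implicitFunction (by simp) hinv'
  have hψb : ψ (0, z₀) = u₀ := hG.implicitFunction_apply_self (by simp) hinv'
  have hψeq : ∀ᶠ q in 𝓝 ((0 : ℝ), z₀), G (q, ψ q) = 0 := by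
    rw [← hGb]; exact hG.eventually_apply_implicitFunction (by simp) hinv'
  have huniq : ∀ᶠ w in 𝓝 b, G w = 0 → ψ w.1 = w.2 := by
    filter_upwards [hG.eventually_apply_eq_iff_implicitFunction (by simp) hinv'] with w hw hw0
    exact hw.1 (hw0.trans hGb.symm)
  let Φ : ℝ × E → E := fun q ↦ ψ q 1
  have hΦ : ContDiffAt ℝ ω Φ (0, z₀) :=
    ((ContinuousMap.evalCLM ℝ (1 : I) : C(I, E) →L[ℝ] E).contDiff.contDiffAt).comp _ hψ
  have hΦb : Φ (0, z₀) = z₀ := by simp [Φ, hψb, u₀]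
  obtain ⟨ε, hε, hball⟩ := Metric.eventually_nhds_iff_ball.1 (huniq.and
    ((continuous_snd.tendsto b).eventually hNX))
  -- Both sides come from solutions with parameter `(ts, z)`: the implicit function there, and `ψ q`
  -- reparametrised by `t`. The latter is no farther from the constant `u₀`, so local uniqueness
  -- identifies them.
  have hscale : ∀ᶠ q in 𝓝 ((0 : ℝ), z₀), ∀ t : I, Φ (t * q.1, q.2) = ψ q t := by
    have hψε : ∀ᶠ q in 𝓝 ((0 : ℝ), z₀), ψ q ∈ Metric.ball u₀ ε := by
      apply hψ.continuousAt.eventually_mem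
      rw [hψb]; exact Metric.ball_mem_nhds _ hε
    filter_upwards [hψeq, hψε, Metric.ball_mem_nhds _ hε] with q hq hqε hqb t
    have hcomp : (ψ q).comp (unitInterval.mulLeft t) ∈ Metric.ball u₀ ε := by
      rw [Metric.mem_ball] at hqε ⊢
      refine lt_of_le_of_lt ?_ hqε
      refine (ContinuousMap.dist_le dist_nonneg).2 fun r ↦ ?_
      exact ContinuousMap.dist_apply_le_dist (f := ψ q) (g := u₀) (unitInterval.mulLeft t r)
    have htq : ((t : ℝ) * q.1, q.2) ∈ Metric.ball ((0 : ℝ), z₀) ε := by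
      rw [Metric.mem_ball, Prod.dist_eq, max_lt_iff] at hqb ⊢
      refine ⟨?_, hqb.2⟩
      refine lt_of_le_of_lt ?_ hqb.1
      simp only [Real.dist_eq, sub_zero, abs_mul, abs_of_nonneg t.2.1]
      exact mul_le_of_le_one_left (abs_nonneg _) t.2.2
    have hmem (q' : ℝ × E) (u : C(I, E)) (h : q' ∈ Metric.ball ((0 : ℝ), z₀) ε)
        (h' : u ∈ Metric.ball u₀ ε) : (q', u) ∈ Metric.ball b ε := by
      rw [Metric.mem_ball, Prod.dist_eq]; exact max_lt h h'
    have hNcomp : N ((ψ q).comp (unitInterval.mulLeft t)) =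
        (N (ψ q)).comp (unitInterval.mulLeft t) := by
      ext r
      rw [(hball _ (hmem _ _ htq hcomp)).2 r, ContinuousMap.comp_apply, ContinuousMap.comp_apply,
        (hball _ (hmem _ _ hqb hqε)).2]
    have hzero : G ((t * q.1, q.2), (ψ q).comp (unitInterval.mulLeft t)) = 0 := by
      have h1 := congrArg (fun u : C(I, E) ↦ u.comp (unitInterval.mulLeft t)) hq
      simp only [G] at h1 ⊢
      rw [hNcomp, mul_comm, mul_smul, ContinuousMap.smul_primitive_comp_mulLeft]
      ext r
      simpa [cst] using congrArg (fun u : C(I, E) ↦ u r) h1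
    have h2 := (hball _ (hmem _ _ htq hcomp)).1 hzero
    change ψ (t * q.1, q.2) 1 = _
    simp only at h2
    rw [h2]
    change ψ q (t * 1) = ψ q t
    rw [mul_one]
  have hevN : ∀ᶠ q in 𝓝 ((0 : ℝ), z₀), ∀ t, N (ψ q) t = X (ψ q t) := by
    have := hψ.continuousAt.tendsto
    rw [hψb] at this
    exact this.eventually hNX
  have hdiff : ∀ᶠ q in 𝓝 ((0 : ℝ), z₀), ContDiffAt ℝ ω Φ q := hΦ.eventually (by simp)
  -- Differentiate `Φ(ts, z)` in `t` at `t = 1`, by the chain rule and by the integral equation. The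
  -- latter is available only on `[0,1]`, hence the one-sided derivative.
  have hode : ∀ᶠ q in 𝓝 ((0 : ℝ), z₀), q.1 • fderiv ℝ Φ q (1, 0) = q.1 • X (Φ q) := by
    filter_upwards [hscale, hψeq, hdiff, hevN] with q hs hq hd hn
    have h1 : HasDerivAt (fun t : ℝ ↦ Φ (t * q.1, q.2)) (q.1 • fderiv ℝ Φ q (1, 0)) 1 := by
      have e1 : HasDerivAt (fun t : ℝ ↦ (t * q.1, q.2)) (q.1, (0 : E)) 1 := by
        have := ((hasDerivAt_id (1 : ℝ)).mul_const q.1).prodMk (hasDerivAt_const (1 : ℝ) q.2)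
        simpa using this
      have e2 : HasFDerivAt Φ (fderiv ℝ Φ q) ((1 : ℝ) * q.1, q.2) := by
        simpa using (hd.differentiableAt (by simp)).hasFDerivAt
      have e3 := e2.comp_hasDerivAt (1 : ℝ) e1
      have e4 : fderiv ℝ Φ q (q.1, 0) = q.1 • fderiv ℝ Φ q (1, 0) := by
        rw [← map_smul]; simp
      rw [← e4]; exact e3
    have h2 : HasDerivWithinAt (fun t : ℝ ↦ Φ (t * q.1, q.2)) (q.1 • X (Φ q)) (Icc 0 1) 1 := by
      have e1 : HasDerivAt (fun t : ℝ ↦ q.2 + q.1 •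
          ∫ r in (0 : ℝ)..t, N (ψ q) (projIcc 0 1 zero_le_one r))
          (q.1 • N (ψ q) (projIcc 0 1 zero_le_one 1)) 1 := by
        have hc : Continuous fun r : ℝ ↦ N (ψ q) (projIcc 0 1 zero_le_one r) := by fun_prop
        exact ((hc.integral_hasStrictDerivAt 0 1).hasDerivAt.const_smul q.1).const_add q.2
      have e2 : N (ψ q) (projIcc 0 1 zero_le_one 1) = X (Φ q) := by
        rw [hn, projIcc_right]; rfl
      rw [e2] at e1
      refine e1.hasDerivWithinAt.congr_of_mem (fun t ht ↦ ?_) (right_mem_Icc.2 zero_le_one)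
      rw [show t = ((⟨t, ht⟩ : I) : ℝ) from rfl, hs ⟨t, ht⟩]
      have := congrArg (fun u : C(I, E) ↦ u ⟨t, ht⟩) hq
      simp only [G, ContinuousMap.sub_apply, ContinuousMap.smul_apply,
        ContinuousMap.primitive_apply, ContinuousMap.zero_apply] at this
      rw [sub_sub, sub_eq_zero] at this
      exact this
    exact (uniqueDiffOn_Icc_zero_one 1 (right_mem_Icc.2 zero_le_one)).eq_deriv _
      h1.hasDerivWithinAt h2
  have hXc : ∀ᶠ q in 𝓝 ((0 : ℝ), z₀), ContinuousAt (fun q ↦ X (Φ q)) q := by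
    have h1 : ∀ᶠ z in 𝓝 (Φ (0, z₀)), ContinuousAt X z := by
      rw [hΦb]; exact hX.eventually_analyticAt.mono fun z hz ↦ hz.continuousAt
    filter_upwards [hΦ.continuousAt.eventually h1, hdiff] with q h2 h3
    exact ContinuousAt.comp h2 h3.continuousAt
  refine ⟨Φ, hΦ.analyticAt, ?_, ?_⟩
  · have h0 : Tendsto (fun z : E ↦ ((0 : ℝ), z)) (𝓝 z₀) (𝓝 (0, z₀)) :=
      (Continuous.prodMk_right (0 : ℝ)).tendsto z₀
    filter_upwards [h0.eventually hψeq] with z hz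
    have := congrArg (fun u : C(I, E) ↦ u 1) hz
    simpa [G, cst, sub_eq_zero] using this
  · filter_upwards [hode.eventually_nhds, hdiff, hXc] with q hq hd hx
    -- The factor `s` cancels when `s ≠ 0`; at `s = 0` the equation follows by continuity of both
    -- sides.
    by_cases hq0 : q.1 = 0
    · obtain ⟨s, z⟩ := q
      subst hq0
      have h0 : Tendsto (fun s : ℝ ↦ (s, z)) (𝓝[≠] 0) (𝓝 (0, z)) :=
        ((Continuous.prodMk_left z).tendsto 0).mono_left nhdsWithin_le_nhds
      have h1 : ContinuousAt (fun q ↦ fderiv ℝ Φ q (1, 0)) (0, z) :=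
        ((hd.fderiv_right (m := 0) (by simp)).continuousAt).clm_apply continuousAt_const
      refine tendsto_nhds_unique ((h1.tendsto.comp h0).congr' ?_) (hx.tendsto.comp h0)
      filter_upwards [h0.eventually hq, self_mem_nhdsWithin] with s hs hs0
      exact smul_right_injective E (show s ≠ 0 from hs0) hs
    · exact smul_right_injective E hq0 hq.self_of_nhds

end Flow

/-! ### Hamiltonian characteristics and the Gauss lemma -/

section Characteristics

variable {E G : Type*} [NormedAddCommGroup E] [NormedSpace ℝ E]
  [NormedAddCommGroup G] [NormedSpace ℝ G]

/-- The mean value inequality on the horizontal segment from `(0, p.2)` to `p`, which stays in any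
ball about the origin containing `p`. -/
theorem eventually_eq_of_fderiv_fst_eq_zero {h : ℝ × ℝ → G}
    (hd : ∀ᶠ p in 𝓝 (0 : ℝ × ℝ), DifferentiableAt ℝ h p)
    (h0 : ∀ᶠ p in 𝓝 (0 : ℝ × ℝ), fderiv ℝ h p (1, 0) = 0) :
    ∀ᶠ p in 𝓝 (0 : ℝ × ℝ), h p = h (0, p.2) := by
  obtain ⟨ε, hε, hb⟩ := Metric.eventually_nhds_iff_ball.1 (hd.and h0)
  filter_upwards [Metric.ball_mem_nhds _ hε] with p hp
  have hmem (t : ℝ) (ht : t ∈ Icc (0 : ℝ) 1) : (t * p.1, p.2) ∈ Metric.ball (0 : ℝ × ℝ) ε := by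
    rw [mem_ball_zero_iff, Prod.norm_def, max_lt_iff] at hp ⊢
    refine ⟨lt_of_le_of_lt ?_ hp.1, hp.2⟩
    rw [norm_mul, Real.norm_of_nonneg ht.1]
    exact mul_le_of_le_one_left (norm_nonneg _) ht.2
  have hder (t : ℝ) (ht : t ∈ Icc (0 : ℝ) 1) :
      HasDerivAt (fun t : ℝ ↦ h (t * p.1, p.2)) 0 t := by
    have e1 : HasDerivAt (fun t : ℝ ↦ (t * p.1, p.2)) (p.1, (0 : ℝ)) t := by
      simpa using ((hasDerivAt_id t).mul_const p.1).prodMk (hasDerivAt_const t p.2)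
    have e2 := (hb _ (hmem t ht)).1.hasFDerivAt.comp_hasDerivAt t e1
    have e3 : fderiv ℝ h (t * p.1, p.2) (p.1, 0) = 0 := by
      have := congrArg (p.1 • ·) (hb _ (hmem t ht)).2
      simpa [← map_smul] using this
    rw [e3] at e2
    exact e2
  have := (convex_Icc (0 : ℝ) 1).norm_image_sub_le_of_norm_hasDerivWithin_le (C := 0)
    (f' := fun _ ↦ (0 : G)) (fun t ht ↦ (hder t ht).hasDerivWithinAt) (by simp)
    (left_mem_Icc.2 zero_le_one) (right_mem_Icc.2 zero_le_one)
  simpa [sub_eq_zero] using this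

/-- The Hamiltonian of the geodesic flow of the cometric `A`. -/
noncomputable def cometricHamiltonian (A : E → (E →L[ℝ] ℝ) →L[ℝ] E) (z : E × (E →L[ℝ] ℝ)) : ℝ :=
  2⁻¹ * z.2 (A z.1 z.2)

/-- The Hamiltonian vector field of the geodesic flow of the cometric `A`. -/
noncomputable def cometricVectorField (A : E → (E →L[ℝ] ℝ) →L[ℝ] E) (z : E × (E →L[ℝ] ℝ)) :
    E × (E →L[ℝ] ℝ) :=
  (A z.1 z.2, -(fderiv ℝ (cometricHamiltonian A) z ∘L .inl ℝ E (E →L[ℝ] ℝ)))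

variable {A : E → (E →L[ℝ] ℝ) →L[ℝ] E}

theorem contDiffAt_cometricHamiltonian {z : E × (E →L[ℝ] ℝ)} (hA : ContDiffAt ℝ ω A z.1) :
    ContDiffAt ℝ ω (cometricHamiltonian A) z := by
  have h : ContDiffAt ℝ ω (fun z : E × (E →L[ℝ] ℝ) ↦ A z.1) z := hA.comp z contDiffAt_fst
  exact contDiffAt_const.mul (contDiffAt_snd.clm_apply (h.clm_apply contDiffAt_snd))

theorem contDiffAt_cometricVectorField {z : E × (E →L[ℝ] ℝ)} (hA : ContDiffAt ℝ ω A z.1) :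
    ContDiffAt ℝ ω (cometricVectorField A) z := by
  have h : ContDiffAt ℝ ω (fun z : E × (E →L[ℝ] ℝ) ↦ A z.1) z := hA.comp z contDiffAt_fst
  have h' : ContDiffAt ℝ ω (fderiv ℝ (cometricHamiltonian A)) z :=
    (contDiffAt_cometricHamiltonian hA).fderiv_right (by simp)
  exact (h.clm_apply contDiffAt_snd).prodMk (h'.clm_comp contDiffAt_const).neg

/-- `H` is quadratic in `ξ`; by symmetry of `A` the two cross terms agree and absorb the factor one
half. -/
theorem fderiv_cometricHamiltonian_inr {z : E × (E →L[ℝ] ℝ)} (hA : ContDiffAt ℝ ω A z.1)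
    (hs : ∀ α β : E →L[ℝ] ℝ, α (A z.1 β) = β (A z.1 α)) (η : E →L[ℝ] ℝ) :
    fderiv ℝ (cometricHamiltonian A) z (0, η) = η (A z.1 z.2) := by
  have e1 : HasDerivAt (fun t : ℝ ↦ (z.1, z.2 + t • η)) ((0 : E), η) 0 := by
    have := ((hasDerivAt_id (0 : ℝ)).smul_const η).const_add z.2
    simpa using (hasDerivAt_const (0 : ℝ) z.1).prodMk this
  have e0 : HasFDerivAt (cometricHamiltonian A) (fderiv ℝ (cometricHamiltonian A) z)
      (z.1, z.2 + (0 : ℝ) • η) := by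
    simpa using ((contDiffAt_cometricHamiltonian hA).differentiableAt (by simp)).hasFDerivAt
  have e2 := e0.comp_hasDerivAt (0 : ℝ) e1
  have e3 : (cometricHamiltonian A ∘ fun t : ℝ ↦ (z.1, z.2 + t • η)) = fun t : ℝ ↦
      2⁻¹ * z.2 (A z.1 z.2) + t * η (A z.1 z.2) + t ^ 2 * (2⁻¹ * η (A z.1 η)) := by
    funext t
    simp only [cometricHamiltonian, Function.comp_apply, map_add, map_smul, smul_eq_mul,
      add_apply, smul_apply, hs z.2 η]
    ring
  rw [e3] at e2
  have e4 : HasDerivAt (fun t : ℝ ↦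
      2⁻¹ * z.2 (A z.1 z.2) + t * η (A z.1 z.2) + t ^ 2 * (2⁻¹ * η (A z.1 η)))
      (η (A z.1 z.2)) 0 := by
    have := (((hasDerivAt_id (0 : ℝ)).mul_const (η (A z.1 z.2))).const_add
      (2⁻¹ * z.2 (A z.1 z.2))).add (((hasDerivAt_id (0 : ℝ)).pow 2).mul_const (2⁻¹ * η (A z.1 η)))
    refine HasDerivAt.congr_deriv (f := fun t : ℝ ↦ _) this ?_
    simp
  exact e2.unique e4

/-- Along the characteristics issued orthogonally from a curve, the unit covector is the
differential of the time parameter. -/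
theorem eventually_characteristics {x : ℝ × ℝ → E} {ξ : ℝ × ℝ → E →L[ℝ] ℝ}
    (hA : ContDiffAt ℝ ω A (x 0))
    (hs : ∀ᶠ y in 𝓝 (x 0), ∀ α β : E →L[ℝ] ℝ, α (A y β) = β (A y α))
    (hx : ContDiffAt ℝ ω x 0) (hξ : ContDiffAt ℝ ω ξ 0)
    (hxt : ∀ᶠ p in 𝓝 0, fderiv ℝ x p (1, 0) = A (x p) (ξ p))
    (hξt : ∀ᶠ p in 𝓝 0, fderiv ℝ ξ p (1, 0) =
      -(fderiv ℝ (cometricHamiltonian A) (x p, ξ p) ∘L .inl ℝ E (E →L[ℝ] ℝ)))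
    (h0 : ∀ᶠ y in 𝓝 (0 : ℝ), ξ (0, y) (A (x (0, y)) (ξ (0, y))) = 1)
    (h1 : ∀ᶠ y in 𝓝 (0 : ℝ), ξ (0, y) (fderiv ℝ x (0, y) (0, 1)) = 0) :
    ∀ᶠ p in 𝓝 0, ξ p (A (x p) (ξ p)) = 1 ∧ ∀ v, ξ p (fderiv ℝ x p v) = v.1 := by
  have hsnd : Tendsto (fun p : ℝ × ℝ ↦ p.2) (𝓝 0) (𝓝 0) := continuous_snd.tendsto 0
  have hA' : ∀ᶠ p in 𝓝 (0 : ℝ × ℝ), ContDiffAt ℝ ω A (x p) :=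
    hx.continuousAt.eventually (hA.eventually (by simp))
  have hs' := hx.continuousAt.eventually hs
  have hxe : ∀ᶠ p in 𝓝 (0 : ℝ × ℝ), ContDiffAt ℝ ω x p := hx.eventually (by simp)
  have hξe : ∀ᶠ p in 𝓝 (0 : ℝ × ℝ), ContDiffAt ℝ ω ξ p := hξ.eventually (by simp)
  let K : ℝ × ℝ → ℝ := fun p ↦ cometricHamiltonian A (x p, ξ p)
  have hKd : ∀ᶠ p in 𝓝 (0 : ℝ × ℝ), HasFDerivAt K (fderiv ℝ (cometricHamiltonian A) (x p, ξ p) ∘L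
      (fderiv ℝ x p).prod (fderiv ℝ ξ p)) p := by
    filter_upwards [hA', hxe, hξe] with p hp1 hp2 hp3
    have e1 : HasFDerivAt (cometricHamiltonian A) _ (x p, ξ p) :=
      ((contDiffAt_cometricHamiltonian (z := (x p, ξ p)) hp1).differentiableAt
        (by simp)).hasFDerivAt
    exact e1.comp p ((hp2.differentiableAt (by simp)).hasFDerivAt.prodMk
      (hp3.differentiableAt (by simp)).hasFDerivAt)
  have hsplit (p : ℝ × ℝ) (u : E) (η : E →L[ℝ] ℝ) :
      fderiv ℝ (cometricHamiltonian A) (x p, ξ p) (u, η) =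
      fderiv ℝ (cometricHamiltonian A) (x p, ξ p) (u, 0) +
      fderiv ℝ (cometricHamiltonian A) (x p, ξ p) (0, η) := by
    rw [← map_add]; simp
  -- Conservation of energy: the position and momentum contributions of the Hamiltonian field
  -- cancel.
  have hK0 : ∀ᶠ p in 𝓝 (0 : ℝ × ℝ), fderiv ℝ K p (1, 0) = 0 := by
    filter_upwards [hKd, hA', hs', hxt, hξt] with p hp1 hp2 hp3 hp4 hp5
    rw [hp1.fderiv, ContinuousLinearMap.comp_apply, ContinuousLinearMap.prod_apply, hp4, hp5,
      hsplit, fderiv_cometricHamiltonian_inr (z := (x p, ξ p)) hp2 hp3]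
    simp
  have hK : ∀ᶠ p in 𝓝 (0 : ℝ × ℝ), K p = 2⁻¹ := by
    filter_upwards [eventually_eq_of_fderiv_fst_eq_zero (hKd.mono fun p hp ↦ hp.differentiableAt)
      hK0, hsnd.eventually h0] with p hp1 hp2
    rw [hp1]
    simp [K, cometricHamiltonian, hp2]
  have hunit : ∀ᶠ p in 𝓝 (0 : ℝ × ℝ), ξ p (A (x p) (ξ p)) = 1 := by
    filter_upwards [hK] with p hp
    simp only [K, cometricHamiltonian] at hp
    linarith
  have hKy : ∀ᶠ p in 𝓝 (0 : ℝ × ℝ), fderiv ℝ K p = 0 := by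
    filter_upwards [hK.eventually_nhds] with p hp
    rw [EventuallyEq.fderiv_eq (f := fun _ ↦ (2⁻¹ : ℝ)) hp]
    simp
  have hpair (w : ℝ × ℝ) : ∀ᶠ p in 𝓝 (0 : ℝ × ℝ), HasFDerivAt (fun p ↦ ξ p (fderiv ℝ x p w))
      ((ξ p) ∘L ((fderiv ℝ (fderiv ℝ x) p).flip w) + (fderiv ℝ ξ p).flip (fderiv ℝ x p w)) p := by
    filter_upwards [hxe, hξe] with p hp1 hp2
    have e1 : HasFDerivAt (fderiv ℝ x) (fderiv ℝ (fderiv ℝ x) p) p :=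
      ((hp1.fderiv_right (m := ω) (by simp)).differentiableAt (by simp)).hasFDerivAt
    have e2 : HasFDerivAt ξ (fderiv ℝ ξ p) p := (hp2.differentiableAt (by simp)).hasFDerivAt
    have e3 : HasFDerivAt (fun p ↦ fderiv ℝ x p w) ((fderiv ℝ (fderiv ℝ x) p).flip w) p := by
      have := e1.clm_apply (hasFDerivAt_const w p)
      simpa using this
    exact e2.clm_apply e3
  have hone : ∀ᶠ p in 𝓝 (0 : ℝ × ℝ), ξ p (fderiv ℝ x p (1, 0)) = 1 := by
    filter_upwards [hunit, hxt] with p hp1 hp2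
    rw [hp2, hp1]
  have hzero : ∀ᶠ p in 𝓝 (0 : ℝ × ℝ), ξ p (fderiv ℝ x p (0, 1)) = 0 := by
    -- By `c3`, `∂_y H = 0` gives `∂_x H(∂_y x) = -∂_y ξ(A ξ)`. By `c2`, differentiating `ξ(∂_t x) =
    -- 1` in `y` gives `ξ(∂_y ∂_t x) = -∂_y ξ(A ξ)`. With `∂_t ξ = -∂_x H` and equality of mixed
    -- derivatives, `∂_t (ξ(∂_y x))` vanishes.
    have hd : ∀ᶠ p in 𝓝 (0 : ℝ × ℝ), fderiv ℝ (fun p ↦ ξ p (fderiv ℝ x p (0, 1))) p (1, 0) = 0 := by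
      filter_upwards [hpair (0, 1), hpair (1, 0), hone.eventually_nhds, hKy, hKd, hA', hs', hxt,
        hξt, hxe] with p hp1 hp2 hp3 hp4 hp5 hp6 hp7 hp8 hp9 hp10
      have c1 : fderiv ℝ (fun p ↦ ξ p (fderiv ℝ x p (1, 0))) p = 0 := by
        rw [EventuallyEq.fderiv_eq (f := fun _ ↦ (1 : ℝ)) hp3]
        simp
      have c2 := congrArg (fun L : ℝ × ℝ →L[ℝ] ℝ ↦ L (0, 1)) (hp2.fderiv.symm.trans c1)
      have c3 := congrArg (fun L : ℝ × ℝ →L[ℝ] ℝ ↦ L (0, 1)) (hp5.fderiv.symm.trans hp4)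
      have c4 : fderiv ℝ (fderiv ℝ x) p (1, 0) (0, 1) = fderiv ℝ (fderiv ℝ x) p (0, 1) (1, 0) :=
        (hp10.isSymmSndFDerivAt (by simp)) (1, 0) (0, 1)
      simp only [ContinuousLinearMap.comp_apply, ContinuousLinearMap.prod_apply,
        zero_apply] at c3
      rw [hsplit, fderiv_cometricHamiltonian_inr (z := (x p, ξ p)) hp6 hp7] at c3
      rw [hp1.fderiv]
      simp only [add_apply, ContinuousLinearMap.comp_apply,
        ContinuousLinearMap.flip_apply, zero_apply] at c2 ⊢
      rw [c4, hp9]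
      rw [hp8] at c2
      simp only [neg_apply, ContinuousLinearMap.comp_apply,
        ContinuousLinearMap.inl_apply]
      linarith
    filter_upwards [eventually_eq_of_fderiv_fst_eq_zero
      ((hpair (0, 1)).mono fun p hp ↦ hp.differentiableAt) hd, hsnd.eventually h1] with p hp1 hp2
    rw [hp1, hp2]
  filter_upwards [hunit, hone, hzero] with p hp1 hp2 hp3
  refine ⟨hp1, fun v ↦ ?_⟩
  have : v = v.1 • ((1 : ℝ), (0 : ℝ)) + v.2 • ((0 : ℝ), (1 : ℝ)) := by ext <;> simp
  conv_lhs => rw [this]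
  simp only [map_add, map_smul, hp2, hp3, smul_eq_mul]
  ring

end Characteristics

/-! ### Local solution of the eikonal equation -/

section Eikonal

variable {E : Type*} [NormedAddCommGroup E] [NormedSpace ℝ E] [FiniteDimensional ℝ E]

/-- Local analytic solvability of the eikonal equation `|dF|² = 1` for an analytic cometric in
dimension two, by a function which is the first coordinate of an analytic chart. -/
theorem exists_eikonal_chart (hE : Module.finrank ℝ E = 2)
    {A : E → (E →L[ℝ] ℝ) →L[ℝ] E} {x₀ : E} (hA : ContDiffAt ℝ ω A x₀)
    (hs : ∀ᶠ y in 𝓝 x₀, ∀ α β : E →L[ℝ] ℝ, α (A y β) = β (A y α))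
    (hpos : ∀ α : E →L[ℝ] ℝ, α ≠ 0 → 0 < α (A x₀ α)) {V : Set E} (hV : V ∈ 𝓝 x₀) :
    ∃ (e : OpenPartialHomeomorph E (ℝ × ℝ)) (r : ℝ), 0 < r ∧ x₀ ∈ e.source ∧ e.source ⊆ V ∧
      e.target = Metric.ball 0 r ∧ ContDiffOn ℝ ω e e.source ∧ ContDiffOn ℝ ω e.symm e.target ∧
      ∀ y ∈ e.source, fderiv ℝ (fun y ↦ (e y).1) y (A y (fderiv ℝ (fun y ↦ (e y).1) y)) = 1 := by
  have : CompleteSpace E := FiniteDimensional.complete ℝ E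
  -- The initial curve is the line through `x₀` in direction `e₁`; `ξ₀` is conormal to it.
  obtain ⟨ξ₀, e₁, hξ₀, hξe, he₁⟩ : ∃ (ξ₀ : E →L[ℝ] ℝ) (e₁ : E), ξ₀ ≠ 0 ∧ ξ₀ e₁ = 0 ∧ e₁ ≠ 0 := by
    let b := Module.finBasisOfFinrankEq ℝ E hE
    refine ⟨(b.coord 0).toContinuousLinearMap, b 1, fun h ↦ ?_, by simp, b.ne_zero 1⟩
    simpa using congrArg (fun L : E →L[ℝ] ℝ ↦ L (b 0)) h
  let N : ℝ → ℝ := fun y ↦ ξ₀ (A (x₀ + y • e₁) ξ₀)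
  have hN0 : 0 < N 0 := by simpa [N] using hpos ξ₀ hξ₀
  have hline : ContDiffAt ℝ ω (fun y : ℝ ↦ x₀ + y • e₁) 0 := by fun_prop
  have hN : ContDiffAt ℝ ω N 0 := by
    have h : ContDiffAt ℝ ω (fun y : ℝ ↦ A (x₀ + y • e₁)) 0 :=
      ContDiffAt.comp (0 : ℝ) (by simpa using hA) hline
    exact contDiffAt_const.clm_apply (h.clm_apply contDiffAt_const)
  -- Normalises `ξ₀` to unit length at each point of the initial line.
  let μ : ℝ → ℝ := fun y ↦ (√(N y))⁻¹
  have hμ : ContDiffAt ℝ ω μ 0 := (hN.sqrt hN0.ne').inv (Real.sqrt_pos.2 hN0).ne'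
  let ι : ℝ → E × (E →L[ℝ] ℝ) := fun y ↦ (x₀ + y • e₁, μ y • ξ₀)
  have hι : ContDiffAt ℝ ω ι 0 := hline.prodMk (hμ.smul contDiffAt_const)
  have hι0 : (ι 0).1 = x₀ := by simp [ι]
  obtain ⟨Φ, hΦ, hΦ0, hΦt⟩ := (contDiffAt_cometricVectorField (A := A) (z := ι 0)
    (by rwa [hι0])).analyticAt.exists_flow
  have hΦ' : ContDiffAt ℝ ω Φ (0, ι 0) := hΦ.contDiffAt
  let c : ℝ × ℝ → ℝ × (E × (E →L[ℝ] ℝ)) := fun p ↦ (p.1, ι p.2)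
  have hc : ContDiffAt ℝ ω c 0 :=
    contDiffAt_fst.prodMk (ContDiffAt.comp (0 : ℝ × ℝ) hι contDiffAt_snd)
  let Z : ℝ × ℝ → E × (E →L[ℝ] ℝ) := fun p ↦ Φ (c p)
  have hZ : ContDiffAt ℝ ω Z 0 := ContDiffAt.comp (0 : ℝ × ℝ) hΦ' hc
  have hc0 : Tendsto c (𝓝 0) (𝓝 (0, ι 0)) := hc.continuousAt.tendsto
  have hZinit : ∀ᶠ y in 𝓝 (0 : ℝ), Z (0, y) = ι y := hι.continuousAt.eventually hΦ0
  have hZ0 : Z 0 = ι 0 := hZinit.self_of_nhds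
  have hZe : ∀ᶠ p in 𝓝 (0 : ℝ × ℝ), ContDiffAt ℝ ω Z p := hZ.eventually (by simp)
  have hZt : ∀ᶠ p in 𝓝 (0 : ℝ × ℝ), fderiv ℝ Z p (1, 0) = cometricVectorField A (Z p) := by
    have hιe : ∀ᶠ p in 𝓝 (0 : ℝ × ℝ), ContDiffAt ℝ ω ι p.2 :=
      (continuous_snd.tendsto (0 : ℝ × ℝ)).eventually (hι.eventually (by simp))
    filter_upwards [hc0.eventually hΦt, hc0.eventually (hΦ'.eventually (by simp)), hιe]
      with p hp1 hp2 hp3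
    have e1 : HasFDerivAt Φ (fderiv ℝ Φ (c p)) (c p) :=
      (hp2.differentiableAt (by simp)).hasFDerivAt
    have e2 : HasFDerivAt c _ p := (hasFDerivAt_fst (𝕜 := ℝ)).prodMk
      ((hp3.differentiableAt (by simp)).hasFDerivAt.comp p hasFDerivAt_snd)
    have e3 : HasFDerivAt Z _ p := e1.comp p e2
    rw [e3.fderiv, ← hp1]
    simp
  let x : ℝ × ℝ → E := fun p ↦ (Z p).1
  let ξ : ℝ × ℝ → E →L[ℝ] ℝ := fun p ↦ (Z p).2
  have hx : ContDiffAt ℝ ω x 0 := hZ.fst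
  have hξ : ContDiffAt ℝ ω ξ 0 := hZ.snd
  have hx0 : x 0 = x₀ := by simp only [x, hZ0, hι0]
  have hxd : ∀ᶠ p in 𝓝 (0 : ℝ × ℝ), ∀ v, fderiv ℝ x p v = (fderiv ℝ Z p v).1 := by
    filter_upwards [hZe] with p hp v
    have := (hp.differentiableAt (by simp)).hasFDerivAt.fst.fderiv
    exact congrArg (fun L : ℝ × ℝ →L[ℝ] E ↦ L v) this
  have hξd : ∀ᶠ p in 𝓝 (0 : ℝ × ℝ), ∀ v, fderiv ℝ ξ p v = (fderiv ℝ Z p v).2 := by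
    filter_upwards [hZe] with p hp v
    have := (hp.differentiableAt (by simp)).hasFDerivAt.snd.fderiv
    exact congrArg (fun L : ℝ × ℝ →L[ℝ] (E →L[ℝ] ℝ) ↦ L v) this
  have hvert : Tendsto (fun y : ℝ ↦ ((0 : ℝ), y)) (𝓝 0) (𝓝 0) :=
    (Continuous.prodMk_right (0 : ℝ)).tendsto 0
  have hxy : ∀ᶠ y in 𝓝 (0 : ℝ), fderiv ℝ x (0, y) (0, 1) = e₁ := by
    filter_upwards [hZinit.eventually_nhds, hvert.eventually hZe] with y hy1 hy2
    have e1 : HasDerivAt (fun y : ℝ ↦ ((0 : ℝ), y)) ((0 : ℝ), (1 : ℝ)) y :=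
      (hasDerivAt_const y (0 : ℝ)).prodMk (hasDerivAt_id y)
    have e2 : HasFDerivAt x (fderiv ℝ x (0, y)) (0, y) :=
      (hy2.fst.differentiableAt (by simp)).hasFDerivAt
    have e3 := e2.comp_hasDerivAt y e1
    have e4 : HasDerivAt (fun y : ℝ ↦ x₀ + y • e₁) e₁ y := by
      simpa using ((hasDerivAt_id y).smul_const e₁).const_add x₀
    have e5 : (x ∘ fun y : ℝ ↦ ((0 : ℝ), y)) =ᶠ[𝓝 y] fun y : ℝ ↦ x₀ + y • e₁ := by
      filter_upwards [hy1] with y' hy'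
      simp [x, hy', ι]
    exact e3.unique (e4.congr_of_eventuallyEq e5)
  have hchar := eventually_characteristics (A := A) (x := x) (ξ := ξ) (by rwa [hx0])
    (by rwa [hx0]) hx hξ
    (by filter_upwards [hZt, hxd] with p hp1 hp2; rw [hp2, hp1]; rfl)
    (by filter_upwards [hZt, hξd] with p hp1 hp2; rw [hp2, hp1]; rfl)
    (by
      filter_upwards [hZinit, hN.continuousAt.eventually (lt_mem_nhds hN0)] with y hy1 hy2
      have e1 : x (0, y) = x₀ + y • e₁ := by simp only [x, hy1, ι]
      have e2 : ξ (0, y) = μ y • ξ₀ := by simp only [ξ, hy1, ι]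
      rw [e1, e2]
      simp only [map_smul, smul_apply, smul_eq_mul]
      change μ y * (μ y * N y) = 1
      have e3 := Real.mul_self_sqrt hy2.le
      have e4 := (Real.sqrt_pos.2 hy2).ne'
      simp only [μ]
      field_simp
      rw [sq, e3])
    (by
      filter_upwards [hZinit, hxy] with y hy1 hy2
      simp [hy2, ξ, hy1, ι, hξe])
  have hxF : HasFDerivAt x (fderiv ℝ x 0) 0 := (hx.differentiableAt (by simp)).hasFDerivAt
  -- Since `ξ(dx v) = v.1`, a kernel vector is vertical, and `dx` sends the vertical unit vector to
  -- `e₁ ≠ 0`.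
  have hinj : Function.Injective (fderiv ℝ x 0) := by
    rw [injective_iff_map_eq_zero]
    intro v hv
    have e1 : v.1 = 0 := by rw [← hchar.self_of_nhds.2 v, hv, map_zero]
    have e2 : v = v.2 • ((0 : ℝ), (1 : ℝ)) := by ext <;> simp [e1]
    have e3 : fderiv ℝ x 0 (0, 1) = e₁ := hxy.self_of_nhds
    rw [e2, map_smul, e3, smul_eq_zero, or_iff_left he₁] at hv
    rw [e2, hv, zero_smul]
  let L : (ℝ × ℝ) ≃L[ℝ] E := (LinearEquiv.ofInjectiveOfFinrankEq
    (fderiv ℝ x 0 : ℝ × ℝ →ₗ[ℝ] E) hinj (by simp [hE])).toContinuousLinearEquiv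
  have hxL : HasFDerivAt x (L : ℝ × ℝ →L[ℝ] E) 0 := by
    convert hxF using 1
    exact ContinuousLinearMap.ext fun _ ↦ rfl
  let e₀ : OpenPartialHomeomorph (ℝ × ℝ) E := hx.toOpenPartialHomeomorph x hxL (by simp)
  have he₀ : (e₀ : ℝ × ℝ → E) = x := rfl
  have h0 : (0 : ℝ × ℝ) ∈ e₀.source := hx.mem_toOpenPartialHomeomorph_source hxL (by simp)
  have hsymm : ContDiffAt ℝ ω e₀.symm (x 0) := hx.to_localInverse hxL (by simp)
  have hgood : ∀ᶠ p in 𝓝 (0 : ℝ × ℝ), p ∈ e₀.source ∧ ContDiffAt ℝ ω x p ∧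
      ContDiffAt ℝ ω e₀.symm (x p) ∧ x p ∈ V ∧
      (ξ p (A (x p) (ξ p)) = 1 ∧ ∀ v, ξ p (fderiv ℝ x p v) = v.1) := by
    refine (e₀.open_source.eventually_mem h0).and ((hx.eventually (by simp)).and
      ((hx.continuousAt.eventually (hsymm.eventually (by simp))).and (Eventually.and ?_ hchar)))
    exact hx.continuousAt.eventually_mem (by rwa [hx0])
  obtain ⟨r, hr, hball⟩ := Metric.eventually_nhds_iff_ball.1 hgood
  let e := (e₀.restrOpen (Metric.ball 0 r) Metric.isOpen_ball).symm
  have htarget : e.target = Metric.ball 0 r :=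
    inter_eq_right.2 fun p hp ↦ (hball p hp).1
  have hsource (y : E) (hy : y ∈ e.source) : e y ∈ Metric.ball (0 : ℝ × ℝ) r ∧ x (e y) = y :=
    ⟨htarget ▸ e.map_source hy, e.left_inv hy⟩
  have hdiff (y : E) (hy : y ∈ e.source) : ContDiffAt ℝ ω e y := by
    obtain ⟨h1, h2⟩ := hsource y hy
    have := (hball _ h1).2.2.1
    rwa [h2] at this
  refine ⟨e, r, hr, ?_, ?_, htarget, ?_, ?_, ?_⟩
  · have : e.symm 0 ∈ e.source := e.map_target (htarget ▸ Metric.mem_ball_self hr)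
    rwa [show e.symm 0 = x₀ from hx0] at this
  · intro y hy
    obtain ⟨h1, h2⟩ := hsource y hy
    rw [← h2]
    exact (hball _ h1).2.2.2.1
  · exact fun y hy ↦ (hdiff y hy).contDiffWithinAt
  · intro p hp
    rw [htarget] at hp
    exact (hball p hp).2.1.contDiffWithinAt
  · intro y hy
    obtain ⟨h1, h2⟩ := hsource y hy
    obtain ⟨-, hd, -, -, hu, hv⟩ := hball _ h1
    have e1 : HasFDerivAt e (fderiv ℝ e y) y :=
      ((hdiff y hy).differentiableAt (by simp)).hasFDerivAt
    have e2 : HasFDerivAt x (fderiv ℝ x (e y)) (e y) := (hd.differentiableAt (by simp)).hasFDerivAt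
    have e3 : fderiv ℝ x (e y) ∘L fderiv ℝ e y = ContinuousLinearMap.id ℝ E := by
      refine (e2.comp y e1).unique ((hasFDerivAt_id y).congr_of_eventuallyEq ?_)
      filter_upwards [e.open_source.mem_nhds hy] with z hz
      exact (hsource z hz).2
    -- Insert `de v` into `ξ(dx w) = w.1` and use `dx ∘ de = id`.
    have e4 : fderiv ℝ (fun y ↦ (e y).1) y = ξ (e y) := by
      rw [e1.fst.fderiv]
      ext v
      have e5 := hv (fderiv ℝ e y v)
      have e6 := congrArg (fun L : E →L[ℝ] E ↦ L v) e3
      simp only [ContinuousLinearMap.comp_apply, ContinuousLinearMap.id_apply] at e6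
      rw [e6] at e5
      exact e5.symm
    rw [e4]
    rwa [h2] at hu

/-- In dimension two, an analytic metric admits locally an analytic function with unit gradient
`n`, which is the first coordinate of an analytic chart. -/
theorem exists_unit_gradient_chart (hE : Module.finrank ℝ E = 2)
    {g : E → E →L[ℝ] E →L[ℝ] ℝ} {x₀ : E} (hg : ContDiffAt ℝ ω g x₀) {V : Set E} (hV : V ∈ 𝓝 x₀)
    (hsymm : ∀ y ∈ V, ∀ v w, g y v w = g y w v) (hpos : ∀ y ∈ V, ∀ v, v ≠ 0 → 0 < g y v v) :
    ∃ (e : OpenPartialHomeomorph E (ℝ × ℝ)) (r : ℝ), 0 < r ∧ x₀ ∈ e.source ∧ e.source ⊆ V ∧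
      e.target = Metric.ball 0 r ∧ ContDiffOn ℝ ω e e.source ∧ ContDiffOn ℝ ω e.symm e.target ∧
      ∀ y ∈ e.source, ∃ n, (∀ u, g y n u = fderiv ℝ (fun y ↦ (e y).1) y u) ∧
        fderiv ℝ (fun y ↦ (e y).1) y n = 1 := by
  have : CompleteSpace E := FiniteDimensional.complete ℝ E
  have hinj (y : E) (hy : y ∈ V) : Function.Injective (g y) := by
    rw [injective_iff_map_eq_zero]
    intro v hv
    by_contra hv0
    simpa [hv] using hpos y hy v hv0
  have hinv (y : E) (hy : y ∈ V) : ∃ L : E ≃L[ℝ] (E →L[ℝ] ℝ), (L : E →L[ℝ] (E →L[ℝ] ℝ)) = g y := by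
    have hdim : Module.finrank ℝ E = Module.finrank ℝ (E →L[ℝ] ℝ) := by
      rw [← LinearMap.toContinuousLinearMap.finrank_eq (R := ℝ) (M := E →ₗ[ℝ] ℝ)]
      exact (Subspace.dual_finrank_eq (K := ℝ) (V := E)).symm
    refine ⟨(LinearEquiv.ofInjectiveOfFinrankEq
      (g y : E →ₗ[ℝ] (E →L[ℝ] ℝ)) (hinj y hy) hdim).toContinuousLinearEquiv, ?_⟩
    ext v w
    rfl
  let A : E → (E →L[ℝ] ℝ) →L[ℝ] E := fun y ↦ (g y).inverse
  have hgA (y : E) (hy : y ∈ V) (α : E →L[ℝ] ℝ) : g y (A y α) = α := by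
    obtain ⟨L, hL⟩ := hinv y hy
    simp only [A, ← hL, ContinuousLinearMap.inverse_equiv]
    exact L.apply_symm_apply α
  have hA : ContDiffAt ℝ ω A x₀ := by
    obtain ⟨L, hL⟩ := hinv x₀ (mem_of_mem_nhds hV)
    have := contDiffAt_map_inverse (n := ω) L
    rw [hL] at this
    exact this.comp x₀ hg
  obtain ⟨e, r, hr, he0, heV, het, hed, hes, heik⟩ := exists_eikonal_chart hE hA
    (by
      filter_upwards [hV] with y hy α β
      conv_lhs => rw [← hgA y hy α, hsymm y hy, hgA y hy])
    (by
      intro α hα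
      have hx := mem_of_mem_nhds hV
      have h1 : A x₀ α ≠ 0 := fun h ↦ hα (by rw [← hgA x₀ hx α, h, map_zero])
      have h2 := hpos x₀ hx _ h1
      rwa [hgA x₀ hx] at h2) hV
  exact ⟨e, r, hr, he0, heV, het, hed, hes, fun y hy ↦
    ⟨A y _, fun u ↦ by rw [hgA y (heV hy)], heik y hy⟩⟩

end Eikonal

/-! ### The metric of the surface in a chart -/

section Surface

variable {M : Type*} [TopologicalSpace M] [ChartedSpace (EuclideanSpace ℝ (Fin 2)) M]
  [IsManifold (𝓡 2) ω M]

/-- A vector of the model space, seen as a tangent vector at `m` in the chart around `p`. -/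
noncomputable def chartVector (p m : M) :
    EuclideanSpace ℝ (Fin 2) →L[ℝ] TangentSpace (𝓡 2) m :=
  (trivializationAt (EuclideanSpace ℝ (Fin 2)) (TangentSpace (𝓡 2)) p).symmL ℝ m

/-- Over the chart domain the tangent bundle trivialization is the differential of the chart, so
`chartVector` inverts that differential. -/
theorem mfderiv_extChartAt_chartVector {p m : M}
    (hm : m ∈ (chartAt (EuclideanSpace ℝ (Fin 2)) p).source) (v : EuclideanSpace ℝ (Fin 2)) :
    mfderiv (𝓡 2) 𝓘(ℝ, EuclideanSpace ℝ (Fin 2)) (extChartAt (𝓡 2) p) m (chartVector p m v) = v := by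
  have : IsManifold (𝓡 2) 1 M := IsManifold.of_le (n := ω) (by simp)
  rw [← TangentBundle.continuousLinearMapAt_trivializationAt hm]
  exact (trivializationAt (EuclideanSpace ℝ (Fin 2)) (TangentSpace (𝓡 2)) p).continuousLinearMapAt_symmL
    (by simpa using hm) v

theorem chartVector_mfderiv_extChartAt {p m : M}
    (hm : m ∈ (chartAt (EuclideanSpace ℝ (Fin 2)) p).source) (u : TangentSpace (𝓡 2) m) :
    chartVector p m (mfderiv (𝓡 2) 𝓘(ℝ, EuclideanSpace ℝ (Fin 2)) (extChartAt (𝓡 2) p) m u) = u := by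
  have : IsManifold (𝓡 2) 1 M := IsManifold.of_le (n := ω) (by simp)
  rw [← TangentBundle.continuousLinearMapAt_trivializationAt hm]
  exact (trivializationAt (EuclideanSpace ℝ (Fin 2)) (TangentSpace (𝓡 2)) p).symmL_continuousLinearMapAt
    (by simpa using hm) u

variable [RiemannianBundle (fun x : M ↦ TangentSpace (𝓡 2) x)]

/-- A fixed model vector gives an analytic local section, the inverse trivialization applied to a
constant; the metric is analytic on such sections. -/
theorem contMDiffAt_inner_chartVector
    [IsContMDiffRiemannianBundle (𝓡 2) ω (EuclideanSpace ℝ (Fin 2))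
      (fun x : M ↦ TangentSpace (𝓡 2) x)] (p : M) (v w : EuclideanSpace ℝ (Fin 2)) :
    ContMDiffAt (𝓡 2) 𝓘(ℝ, ℝ) ω (fun m : M ↦ inner ℝ (chartVector p m v) (chartVector p m w)) p := by
  have h (v : EuclideanSpace ℝ (Fin 2)) : ContMDiffAt (𝓡 2) ((𝓡 2).prod 𝓘(ℝ, EuclideanSpace ℝ (Fin 2)))
      ω (fun m : M ↦ (⟨m, chartVector p m v⟩ : TotalSpace (EuclideanSpace ℝ (Fin 2))
        (TangentSpace (𝓡 2) : M → Type))) p := by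
    let T := trivializationAt (EuclideanSpace ℝ (Fin 2)) (TangentSpace (𝓡 2) : M → Type) p
    have hp : p ∈ T.baseSet := FiberBundle.mem_baseSet_trivializationAt' p
    have h1 : ContMDiffAt ((𝓡 2).prod 𝓘(ℝ, EuclideanSpace ℝ (Fin 2)))
        ((𝓡 2).prod 𝓘(ℝ, EuclideanSpace ℝ (Fin 2))) ω T.toOpenPartialHomeomorph.symm (p, v) :=
      T.contMDiffOn_symm.contMDiffAt (T.open_target.mem_nhds (T.mk_mem_target.2 hp))
    have h2 : ContMDiffAt (𝓡 2) ((𝓡 2).prod 𝓘(ℝ, EuclideanSpace ℝ (Fin 2))) ω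
        (fun m : M ↦ (m, v)) p := contMDiffAt_id.prodMk contMDiffAt_const
    refine (ContMDiffAt.comp p h1 h2).congr_of_eventuallyEq ?_
    filter_upwards [T.open_baseSet.mem_nhds hp] with m hm
    rw [Function.comp_apply, ← T.mk_symm hm v, chartVector, Trivialization.symmL_apply]
    exact hm
  exact (h v).inner_bundle (h w)

/-- The metric at `m`, read in the chart around `p`. -/
noncomputable def chartMetric (p m : M) :
    EuclideanSpace ℝ (Fin 2) →L[ℝ] EuclideanSpace ℝ (Fin 2) →L[ℝ] ℝ :=
  ∑ i, ∑ j, (inner ℝ (chartVector p m (EuclideanSpace.single i 1))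
    (chartVector p m (EuclideanSpace.single j 1)) : ℝ) •
    (EuclideanSpace.proj i : EuclideanSpace ℝ (Fin 2) →L[ℝ] ℝ).smulRight
      (EuclideanSpace.proj j : EuclideanSpace ℝ (Fin 2) →L[ℝ] ℝ)

theorem chartMetric_apply (p m : M) (v w : EuclideanSpace ℝ (Fin 2)) :
    chartMetric p m v w = inner ℝ (chartVector p m v) (chartVector p m w) := by
  have h (v : EuclideanSpace ℝ (Fin 2)) : v = ∑ i, v i • EuclideanSpace.single i (1 : ℝ) := by
    ext k; fin_cases k <;> simp
  conv_rhs => rw [h v, h w]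
  simp only [chartMetric, Fin.sum_univ_two, map_add, map_smul, inner_add_left, inner_add_right,
    inner_smul_left, inner_smul_right, add_apply, smul_apply,
    ContinuousLinearMap.smulRight_apply, conj_trivial, smul_eq_mul, PiLp.proj_apply]
  ring

theorem contMDiffAt_chartMetric
    [IsContMDiffRiemannianBundle (𝓡 2) ω (EuclideanSpace ℝ (Fin 2))
      (fun x : M ↦ TangentSpace (𝓡 2) x)] (p : M) :
    ContMDiffAt (𝓡 2) 𝓘(ℝ, EuclideanSpace ℝ (Fin 2) →L[ℝ] EuclideanSpace ℝ (Fin 2) →L[ℝ] ℝ) ω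
      (chartMetric p) p := by
  -- The expansion in matrix entries reduces analyticity to scalar coefficients.
  unfold chartMetric
  refine contMDiffAt_finsetSum fun i _ ↦ contMDiffAt_finsetSum fun j _ ↦ ?_
  exact (contMDiffAt_inner_chartVector p _ _).smul contMDiffAt_const

/-- A linear form of unit norm preserves inner products of vectors orthogonal to its kernel. -/
theorem inner_eq_of_unit_gradient {V : Type*} [NormedAddCommGroup V] [InnerProductSpace ℝ V]
    (L : V →ₗ[ℝ] ℝ) (n : V) (hn : ∀ u, inner ℝ n u = L u) (hn1 : L n = 1) {v w : V}
    (hv : ∀ k, L k = 0 → inner ℝ k v = 0) : L v * L w = inner ℝ v w := by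
  -- The vector `v - L v • n` lies in the kernel and is orthogonal to it, as `v` and `n` are, so it
  -- is zero and `v = L v • n`.
  have hk : L (v - L v • n) = 0 := by simp [hn1]
  have h0 : v - L v • n = 0 := by
    rw [← inner_self_eq_zero (𝕜 := ℝ), inner_sub_right, hv _ hk, inner_smul_right,
      real_inner_comm, hn, hk]
    simp
  rw [sub_eq_zero] at h0
  conv_rhs => rw [h0, inner_smul_left, hn]
  simp

end Surface

/-! ### Transfer of the eikonal chart to the surface -/

theorem mainTheorem7
    {M : Type*} [TopologicalSpace M] [ChartedSpace (EuclideanSpace ℝ (Fin 2)) M]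
    [IsManifold (𝓡 2) ω M]
    [RiemannianBundle (fun x : M ↦ TangentSpace (𝓡 2) x)]
    [IsContMDiffRiemannianBundle (𝓡 2) ω (EuclideanSpace ℝ (Fin 2))
      (fun x : M ↦ TangentSpace (𝓡 2) x)]
    (p : M) :
    ∃ (U : Set M) (f : M → ℝ) (a b : ℝ),
      p ∈ U ∧ IsRiemannianFoliationBy ω f U a b := by
  have : IsManifold (𝓡 2) 1 M := IsManifold.of_le (n := ω) (by simp)
  let φ := chartAt (EuclideanSpace ℝ (Fin 2)) p
  have hpφ : p ∈ φ.source := mem_chart_source _ p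
  let g : EuclideanSpace ℝ (Fin 2) → EuclideanSpace ℝ (Fin 2) →L[ℝ] EuclideanSpace ℝ (Fin 2) →L[ℝ] ℝ :=
    fun y ↦ chartMetric p (φ.symm y)
  have hg : ContDiffAt ℝ ω g (φ p) := by
    rw [← contMDiffAt_iff_contDiffAt]
    have h1 : ContMDiffAt (𝓡 2) (𝓡 2) ω φ.symm (φ p) :=
      contMDiffOn_chart_symm.contMDiffAt (φ.open_target.mem_nhds (φ.map_source hpφ))
    have h2 : ContMDiffAt (𝓡 2) 𝓘(ℝ, EuclideanSpace ℝ (Fin 2) →L[ℝ] EuclideanSpace ℝ (Fin 2) →L[ℝ] ℝ)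
        ω (chartMetric p) (φ.symm (φ p)) := by
      rw [φ.left_inv hpφ]; exact contMDiffAt_chartMetric p
    exact ContMDiffAt.comp (g := chartMetric p) (φ p) h2 h1
  obtain ⟨e, r, hr, he0, heφ, het, hed, hes, hen⟩ := exists_unit_gradient_chart
    (by simp) hg (φ.open_target.mem_nhds (φ.map_source hpφ))
    (by
      intro y _ v w
      simp only [g, chartMetric_apply]
      exact real_inner_comm _ _)
    (by
      intro y hy v hv
      simp only [g, chartMetric_apply]
      refine real_inner_self_pos.2 fun h ↦ hv ?_
      rw [← mfderiv_extChartAt_chartVector (φ.map_target hy) v, h, map_zero]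
      rfl)
  let L : (ℝ × ℝ) ≃L[ℝ] EuclideanSpace ℝ (Fin 2) :=
    (ContinuousLinearEquiv.finTwoArrow ℝ ℝ).symm.trans (EuclideanSpace.equiv (Fin 2) ℝ).symm
  let ψ : OpenPartialHomeomorph M (EuclideanSpace ℝ (Fin 2)) :=
    (φ ≫ₕ e) ≫ₕ L.toHomeomorph.toOpenPartialHomeomorph
  have hsrc : ψ.source = φ.source ∩ φ ⁻¹' e.source := by
    simp [ψ]
  have hψ0 (m : M) : ψ m 0 = (e (φ m)).1 := rfl
  -- The ball of the sup norm on `ℝ × ℝ` is an open square, hence the required rectangle.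
  have htgt : ψ.target = {z | z 0 ∈ Ioo (-r) r ∧ z 1 ∈ Ioo (-r) r} := by
    ext z
    have h1 : z ∈ ψ.target ↔ L.symm z ∈ e.target := by
      simp only [ψ, OpenPartialHomeomorph.trans_target]
      constructor
      · intro h; exact h.2.1
      · intro h; exact ⟨trivial, h, heφ (e.map_target h)⟩
    have h2 : L.symm z = (z 0, z 1) := rfl
    rw [h1, het, h2, mem_ball_zero_iff, Prod.norm_def, max_lt_iff, Real.norm_eq_abs,
      Real.norm_eq_abs, abs_lt, abs_lt]
    rfl
  have hφs : ContMDiffOn (𝓡 2) (𝓡 2) ω φ φ.source := contMDiffOn_chart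
  have heφs : ContMDiffOn (𝓡 2) 𝓘(ℝ, ℝ × ℝ) ω (fun m ↦ e (φ m)) ψ.source := by
    rw [hsrc]
    exact hed.contMDiffOn.comp (hφs.mono inter_subset_left) fun m hm ↦ hm.2
  have hf : ContMDiffOn (𝓡 2) 𝓘(ℝ, ℝ) ω (fun m ↦ (e (φ m)).1) ψ.source :=
    (ContinuousLinearMap.fst ℝ ℝ ℝ).contMDiff.comp_contMDiffOn heφs
  -- The unit gradient found in the chart, carried to the surface by `chartVector`.
  have hgrad (m : M) (hm : m ∈ ψ.source) : ∃ n : TangentSpace (𝓡 2) m,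
      (∀ u : TangentSpace (𝓡 2) m,
        inner ℝ n u = mfderiv (𝓡 2) 𝓘(ℝ, ℝ) (fun m ↦ (e (φ m)).1) m u) ∧
      mfderiv (𝓡 2) 𝓘(ℝ, ℝ) (fun m ↦ (e (φ m)).1) m n = (1 : ℝ) := by
    rw [hsrc] at hm
    obtain ⟨n, hn, hn1⟩ := hen _ hm.2
    have hF : DifferentiableAt ℝ (fun y ↦ (e y).1) (φ m) :=
      ((hed.contDiffAt (e.open_source.mem_nhds hm.2)).differentiableAt (by simp)).fst
    have hder (u : TangentSpace (𝓡 2) m) : mfderiv (𝓡 2) 𝓘(ℝ, ℝ) (fun m ↦ (e (φ m)).1) m u =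
        fderiv ℝ (fun y ↦ (e y).1) (φ m)
          (mfderiv (𝓡 2) 𝓘(ℝ, EuclideanSpace ℝ (Fin 2)) (extChartAt (𝓡 2) p) m u) := by
      have h1 : MDifferentiableAt (𝓡 2) 𝓘(ℝ, EuclideanSpace ℝ (Fin 2)) (extChartAt (𝓡 2) p) m :=
        mdifferentiableAt_extChartAt hm.1
      have h2 := mfderiv_comp m (g := fun y ↦ (e y).1) (f := extChartAt (𝓡 2) p)
        hF.mdifferentiableAt h1
      rw [mfderiv_eq_fderiv] at h2
      exact congrArg (fun T : TangentSpace (𝓡 2) m →L[ℝ] ℝ ↦ T u) h2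
    refine ⟨chartVector p m n, fun u ↦ ?_, ?_⟩
    · refine Eq.trans ?_ ((hn _).trans (hder u).symm)
      simp only [g]
      rw [φ.left_inv hm.1]
      exact (congrArg (inner ℝ (chartVector p m n))
        (chartVector_mfderiv_extChartAt hm.1 u).symm).trans (chartMetric_apply p m n _).symm
    · rw [hder, mfderiv_extChartAt_chartVector hm.1, hn1]
  have hatlas : ψ ∈ IsManifold.maximalAtlas (𝓡 2) ω M := by
    refine ψ.mem_maximalAtlas_of_contMDiffOn ?_ ?_
    · exact L.toContinuousLinearMap.contMDiff.comp_contMDiffOn heφs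
    · have h1 : ContMDiffOn (𝓡 2) 𝓘(ℝ, ℝ × ℝ) ω L.symm ψ.target :=
        L.symm.toContinuousLinearMap.contMDiff.contMDiffOn
      have h2 : MapsTo L.symm ψ.target e.target := fun z hz ↦ hz.2.1
      have h3 : ContMDiffOn (𝓡 2) (𝓡 2) ω φ.symm φ.target := contMDiffOn_chart_symm
      exact h3.comp (hes.contMDiffOn.comp h1 h2) fun z hz ↦ heφ (e.map_target (h2 hz))
  refine ⟨ψ.source, fun m ↦ (e (φ m)).1, -r, r, by rw [hsrc]; exact ⟨hpφ, he0⟩,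
    ⟨⟨ψ.open_source, hf, ?_, ?_⟩, ?_, ψ, hatlas, -r, r, rfl, htgt, fun m _ ↦ hψ0 m⟩⟩
  · intro m hm t
    obtain ⟨n, -, hn1⟩ := hgrad m hm
    let s : ℝ := t
    refine ⟨s • n, ?_⟩
    rw [map_smul, hn1]
    exact mul_one s
  · intro m hm v w hv _
    obtain ⟨n, hn, hn1⟩ := hgrad m hm
    let D : TangentSpace (𝓡 2) m →L[ℝ] ℝ := mfderiv (𝓡 2) 𝓘(ℝ, ℝ) (fun m ↦ (e (φ m)).1) m
    have := inner_eq_of_unit_gradient (D : TangentSpace (𝓡 2) m →ₗ[ℝ] ℝ) n hn hn1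
      (v := v) (w := w) hv
    rw [← this]
    exact mul_comm _ _
  · ext t
    constructor
    · rintro ⟨m, hm, rfl⟩
      have := ψ.map_source hm
      rw [htgt] at this
      exact this.1
    · intro ht
      -- Each value `t` is attained on the horizontal axis of the square.
      have hz : L (t, 0) ∈ ψ.target := by
        rw [htgt]
        exact ⟨ht, by change (0 : ℝ) ∈ Ioo (-r) r; constructor <;> linarith⟩
      refine ⟨ψ.symm (L (t, 0)), ψ.map_target hz, ?_⟩
      change (e (φ (ψ.symm (L (t, 0))))).1 = t
      rw [← hψ0, ψ.right_inv hz]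
      rfl
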